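/- Let $A>1$. For $d\ge 1$ let $\mathcal F_d(A)$ be the set of probability densities on $\mathbb R^d$ with respect to Lebesgue measure that are bounded by $A$ (that is, measurable $f:\mathbb R^d\to[0,A]$ with $\int f=1$). For densities $f,g$ let $P_f$ be the distribution of density $f$, and let $K(f|g)=\int f\log(f/g)$ if $P_f\ll P_g$ and $K(f|g)=+\infty$ otherwise. An estimator $\hat f_n$ based on a sample $X_1,\dots,X_n$ is a map that sends each sample to a probability density on $\mathbb R^d$, jointly measurable in the sample and the point of evaluation; $\mathbb E_f$ is the expectation when $X_1,\dots,X_n$ are i.i.d. of density $f$. For $f_1,\dots,f_M$ define the aggregate with exponential weights (progressive mixture) $$\tilde f_n=\sum_{j=1}^M\tilde w_j^{(n)}f_j,\qquad \tilde w_j^{(n)}=\frac1{n+1}\sum_{k=0}^n w_j^{(k)},\qquad w_j^{(k)}=\frac{f_j(X_1)\cdots f_j(X_k)}{\sum_{l=1}^M f_l(X_1)\cdots f_l(X_k)},\qquad w_j^{(0)}=\frac1M,$$ with $w_j^{(k)}=1/M$ if the denominator vanishes. **Theorem.** $\frac{\log M}{n}$ is an optimal rate of aggregation of $M$ functions in $(\mathcal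 F_d(A),\mathcal F_d(A))$ with respect to the Kullback–Leibler loss, and the progressive mixture is an optimal aggregation procedure. That is, there are constants $C,c>0$ depending only on $A$ such that for all integers $d\ge1$, $M\ge2$ and $n\ge1$ with $\log M\le 16(\min(1,A-1))^2\,n$: 1. for all $f_1,\dots,f_M\in\mathcal F_d(A)$ there is an estimator with values in $\mathcal F_d(A)$, namely the progressive mixture $\tilde f_n$, such that $$\sup_{f\in\mathcal F_d(A)}\Big[\mathbb E_f K(f|\tilde f_n)-\min_{j=1,\dots,M}K(f|f_j)\Big]\le C\,\frac{\log M}{n};$$ 2. there are $f_1,\dots,f_M\in\mathcal F_d(A)$ (which may depend on $M$, $n$ and $d$) such that for every estimator $\hat f_n$ $$\sup_{f\in\mathcal F_d(A)}\Big[\mathbb E_f K(f|\hat f_n)-\min_{j=1,\dots,M}K(f|f_j)\Big]\ge c\,\frac{\log M}{n}.$$ In both suprema, densities $f$ with $\min_j K(f|f_j)=+\infty$ are disregarded. -/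

import Mathlib

open MeasureTheory
open scoped ENNReal

namespace DensityAggregation

noncomputable section

/-- `f` is a probability density with respect to `ν`. -/
structure IsDensity {X : Type*} [MeasurableSpace X] (ν : Measure X) (f : X → ℝ) : Prop where
  measurable : Measurable f
  nonneg : ∀ x, 0 ≤ f x
  lintegral_eq_one : ∫⁻ x, ENNReal.ofReal (f x) ∂ν = 1

/-- The set of the probability densities with respect to `ν` that are bounded by `A`. -/
def densitiesBoundedBy {X : Type*} [MeasurableSpace X] (ν : Measure X) (A : ℝ) :
    Set (X → ℝ) :=
  {f | IsDensity ν f ∧ ∀ x, f x ≤ A}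

/-- The distribution `P_f` of density `f` with respect to `ν`. -/
def law {X : Type*} [MeasurableSpace X] (ν : Measure X) (f : X → ℝ) : Measure X :=
  ν.withDensity (fun x => ENNReal.ofReal (f x))

/-- The Kullback–Leibler loss `K(f|g)`, with values in `[0, ∞]`. -/
def klLoss {X : Type*} [MeasurableSpace X] (ν : Measure X) (f g : X → ℝ) : ℝ≥0∞ :=
  InformationTheory.klDiv (law ν f) (law ν g)

/-- A (density) estimator based on a sample of size `n`: a map that sends every sample to a
density, measurable jointly in the sample and the point of evaluation. -/
structure IsEstimator {X : Type*} [MeasurableSpace X] (ν : Measure X) (n : ℕ)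
    (fhat : (Fin n → X) → X → ℝ) : Prop where
  measurable : Measurable (fun p : (Fin n → X) × X => fhat p.1 p.2)
  isDensity : ∀ x, IsDensity ν (fhat x)

/-- The risk `E_f [K(f|fhat)]`, the sample consisting of `n` i.i.d. observations of density `f`. -/
def klRisk {X : Type*} [MeasurableSpace X] (ν : Measure X) {n : ℕ}
    (fhat : (Fin n → X) → X → ℝ) (f : X → ℝ) : ℝ≥0∞ :=
  ∫⁻ x, klLoss ν f (fhat x) ∂(Measure.pi (fun _ : Fin n => law ν f))

/-- The excess risk `E_f [K(f|fhat)] - min_j K(f|f_j)`. It is `⊥` in `EReal` if the minimum is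
infinite, so such an `f` plays no role in the suprema below. -/
def excessRisk {X : Type*} [MeasurableSpace X] (ν : Measure X) {M n : ℕ}
    (fs : Fin M → X → ℝ) (fhat : (Fin n → X) → X → ℝ) (f : X → ℝ) : EReal :=
  ((klRisk ν fhat f : ℝ≥0∞) : EReal) - ((⨅ j, klLoss ν f (fs j) : ℝ≥0∞) : EReal)

/-- The estimator `fhat` takes its values in `F₀` (where the loss is considered), and its worst
excess risk over `F` with respect to `fs` is at most `r`. -/
def AttainsUpperBound {X : Type*} [MeasurableSpace X] (ν : Measure X) (F₀ F : Set (X → ℝ))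
    {M n : ℕ} (fs : Fin M → X → ℝ) (fhat : (Fin n → X) → X → ℝ) (r : ℝ) : Prop :=
  IsEstimator ν n fhat ∧ (∀ x, fhat x ∈ F₀) ∧
    ⨆ f ∈ F, excessRisk ν fs fhat f ≤ (r : EReal)

/-- The lower bound in the definition of an optimal rate of aggregation, with constant `c`, for
all numbers `M ≥ 2` of functions and all sample sizes `n ≥ 1` such that `range M n`. -/
def LowerBound {X : Type*} [MeasurableSpace X] (ν : Measure X) (F₀ F : Set (X → ℝ))
    (range : ℕ → ℕ → Prop) (ψ : ℕ → ℕ → ℝ) (c : ℝ) : Prop :=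
  ∀ M n : ℕ, 2 ≤ M → 1 ≤ n → range M n →
    ∃ fs : Fin M → X → ℝ, (∀ j, fs j ∈ F₀) ∧
      ∀ fhat : (Fin n → X) → X → ℝ, IsEstimator ν n fhat →
        ((c * ψ M n : ℝ) : EReal) ≤ ⨆ f ∈ F, excessRisk ν fs fhat f

/-- `ψ M n` is an optimal rate of aggregation of `M` functions in `(F₀, F)` with respect to the
Kullback–Leibler loss, in the given range of `(M, n)`, with constants `C` and `c`. -/
def IsOptimalRate {X : Type*} [MeasurableSpace X] (ν : Measure X) (F₀ F : Set (X → ℝ))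
    (range : ℕ → ℕ → Prop) (ψ : ℕ → ℕ → ℝ) (C c : ℝ) : Prop :=
  (∀ M : ℕ, 2 ≤ M → ∀ fs : Fin M → X → ℝ, (∀ j, fs j ∈ F₀) →
    ∃ ftilde : ∀ n : ℕ, (Fin n → X) → X → ℝ,
      ∀ n : ℕ, 1 ≤ n → range M n →
        AttainsUpperBound ν F₀ F fs (ftilde n) (C * ψ M n)) ∧
  LowerBound ν F₀ F range ψ c

/-- The aggregation procedure `agg` is optimal with respect to the Kullback–Leibler loss: it
attains the upper bound `C * ψ M n`, and the matching lower bound `c * ψ M n` holds. -/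
def IsOptimalProcedure {X : Type*} [MeasurableSpace X] (ν : Measure X) (F₀ F : Set (X → ℝ))
    (range : ℕ → ℕ → Prop) (ψ : ℕ → ℕ → ℝ) (C c : ℝ)
    (agg : ∀ M n : ℕ, (Fin M → X → ℝ) → (Fin n → X) → X → ℝ) : Prop :=
  (∀ M : ℕ, 2 ≤ M → ∀ fs : Fin M → X → ℝ, (∀ j, fs j ∈ F₀) →
    ∀ n : ℕ, 1 ≤ n → range M n →
      AttainsUpperBound ν F₀ F fs (agg M n fs) (C * ψ M n)) ∧
  LowerBound ν F₀ F range ψ c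

/-- The likelihood `g(X_1) ⋯ g(X_k)` of `g` at the first `k` observations. -/
def likelihood {X : Type*} {n : ℕ} (g : X → ℝ) (x : Fin n → X) (k : ℕ) : ℝ :=
  ∏ i : Fin n with i.val < k, g (x i)

/-- The weight `w_j^{(k)}` of `f_j` after `k` observations, `k = 0, …, n`; it is `1 / M` for
`k = 0`, and also if all the likelihoods vanish. -/
def weight {X : Type*} {M n : ℕ} (fs : Fin M → X → ℝ) (x : Fin n → X) (k : ℕ)
    (j : Fin M) : ℝ :=
  if ∑ l, likelihood (fs l) x k = 0 then 1 / (M : ℝ)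
  else likelihood (fs j) x k / ∑ l, likelihood (fs l) x k

/-- The averaged weight `(n + 1)⁻¹ ∑_{k=0}^n w_j^{(k)}`. -/
def averagedWeight {X : Type*} {M n : ℕ} (fs : Fin M → X → ℝ) (x : Fin n → X)
    (j : Fin M) : ℝ :=
  ((n : ℝ) + 1)⁻¹ * ∑ k ∈ Finset.range (n + 1), weight fs x k j

/-- The aggregate with exponential weights (progressive mixture). -/
def progressiveMixture {X : Type*} (M n : ℕ) (fs : Fin M → X → ℝ) (x : Fin n → X) : X → ℝ :=
  fun y => ∑ j, averagedWeight fs x j * fs j y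

end

end DensityAggregation

/-!
*Upper bound.* Fix `j`. Minus the logarithm of the posterior weight of `f_j` starts at `log M`, and
by Bayes' rule one more observation changes its expectation by at most
`K(f|f_j) - K(f|∑_l w_l^{(k)} f_l)`. Summing over the `n + 1` mixtures bounds their total risk by
`log M + (n + 1) K(f|f_j)`, and convexity of `K(f|·)` passes to the average.

*Lower bound.* Let `f_j` put mass `1 - δ` on a common set and mass `δ` on a set of its own, with
`δ = 1 / (n + 1)`. With probability `(1 - δ)^n ≥ 1 / e` the sample stays in the common set and says
nothing about `j`, whereas every density `g` satisfies `∑_j K(f_j|g) ≥ M δ log M`, since it has to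
share its mass among the `M` other sets.
-/

namespace DensityAggregation

noncomputable section

open InformationTheory

section KLIntegrand

/-- The integrand `b φ(a / b) = a log (a / b) + b - a`, `φ = klFun`, of the Kullback–Leibler
divergence between densities with values `a` and `b`. The additional `b - a` has integral `0` and
makes it nonnegative. At `b = 0` it is the limit: `0` if `a = 0` and `∞` otherwise. -/
def klIntegrand (a b : ℝ) : ℝ≥0∞ :=
  if b = 0 ∧ a ≠ 0 then ⊤ else ENNReal.ofReal (b * klFun (a / b))

variable {a b c : ℝ}

lemma klIntegrand_zero_left (b : ℝ) : klIntegrand 0 b = ENNReal.ofReal b := by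
  simp [klIntegrand, klFun_zero]

lemma klIntegrand_zero_right (ha : a ≠ 0) : klIntegrand a 0 = ⊤ := by
  simp [klIntegrand, ha]

lemma mul_klFun_div (a : ℝ) (hb : b ≠ 0) : b * klFun (a / b) = a * Real.log (a / b) + b - a := by
  rw [klFun_apply]
  field_simp

lemma klIntegrand_of_ne_zero (a : ℝ) (hb : b ≠ 0) :
    klIntegrand a b = ENNReal.ofReal (a * Real.log (a / b) + b - a) := by
  rw [klIntegrand, if_neg fun h => hb h.1, mul_klFun_div a hb]

lemma mul_log_div_add_sub_nonneg (ha : 0 ≤ a) (hb : 0 < b) :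
    0 ≤ a * Real.log (a / b) + b - a :=
  mul_klFun_div a hb.ne' ▸ mul_nonneg hb.le (klFun_nonneg (div_nonneg ha hb.le))

lemma measurable_klIntegrand {X : Type*} [MeasurableSpace X] {f g : X → ℝ} (hf : Measurable f)
    (hg : Measurable g) : Measurable fun x => klIntegrand (f x) (g x) :=
  Measurable.ite ((hg (measurableSet_singleton 0)).inter (hf (measurableSet_singleton 0)).compl)
    measurable_const (hg.mul (measurable_klFun.comp (hf.div hg))).ennreal_ofReal

-- The tangent of the convex function `klIntegrand a` at `c`, stated without subtraction.
lemma klIntegrand_add_le_tangent (ha : 0 < a) (hb : 0 ≤ b) (hc : 0 < c) :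
    klIntegrand a c + ENNReal.ofReal b + ENNReal.ofReal a ≤
      klIntegrand a b + ENNReal.ofReal (a / c) * ENNReal.ofReal b + ENNReal.ofReal c := by
  rcases hb.eq_or_lt with rfl | hb
  · simp [klIntegrand_zero_right ha.ne']
  have hac := mul_log_div_add_sub_nonneg ha.le hc
  have hab := mul_log_div_add_sub_nonneg ha.le hb
  rw [klIntegrand_of_ne_zero a hb.ne', klIntegrand_of_ne_zero a hc.ne',
    ← ENNReal.ofReal_mul (by positivity), ← ENNReal.ofReal_add hac hb.le,
    ← ENNReal.ofReal_add (by positivity) ha.le, ← ENNReal.ofReal_add hab (by positivity),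
    ← ENNReal.ofReal_add (by positivity) hc.le]
  refine ENNReal.ofReal_le_ofReal ?_
  have htangent : a * Real.log (b / c) ≤ a * (b / c - 1) :=
    mul_le_mul_of_nonneg_left (Real.log_le_sub_one_of_pos (div_pos hb hc)) ha.le
  have hlog : Real.log (a / c) = Real.log (a / b) + Real.log (b / c) := by
    rw [← Real.log_mul (by positivity) (by positivity), div_mul_div_cancel₀ hb.ne']
  rw [hlog]
  linear_combination htangent

end KLIntegrand

section Mixture

variable {X ι : Type*} [Fintype ι]

/-- The mixture `∑ⱼ wⱼ fⱼ` of the functions `fs` with weights `w`. -/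
def mixture (w : ι → ℝ) (fs : ι → X → ℝ) (y : X) : ℝ := ∑ j, w j * fs j y

/-- The weight of `fs j` updated by Bayes' rule from the prior weights `w` after the observation
`y`. It is `0` if the mixture vanishes at `y`. -/
def posteriorWeight (w : ι → ℝ) (fs : ι → X → ℝ) (y : X) (j : ι) : ℝ :=
  w j * fs j y / mixture w fs y

variable {w : ι → ℝ} {fs : ι → X → ℝ}

lemma mixture_nonneg (hw : ∀ j, 0 ≤ w j) {y : X} (hfs : ∀ j, 0 ≤ fs j y) : 0 ≤ mixture w fs y :=
  Finset.sum_nonneg fun j _ => mul_nonneg (hw j) (hfs j)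

lemma mul_le_mixture (hw : ∀ j, 0 ≤ w j) {y : X} (hfs : ∀ j, 0 ≤ fs j y) (j : ι) :
    w j * fs j y ≤ mixture w fs y :=
  Finset.single_le_sum (f := fun j => w j * fs j y) (fun l _ => mul_nonneg (hw l) (hfs l))
    (Finset.mem_univ j)

lemma ofReal_mixture (hw : ∀ j, 0 ≤ w j) {y : X} (hfs : ∀ j, 0 ≤ fs j y) :
    ENNReal.ofReal (mixture w fs y) = ∑ j, ENNReal.ofReal (w j) * ENNReal.ofReal (fs j y) := by
  rw [mixture, ENNReal.ofReal_sum_of_nonneg fun j _ => mul_nonneg (hw j) (hfs j)]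
  simp only [ENNReal.ofReal_mul (hw _)]

lemma sum_ofReal_of_mem_stdSimplex (hw : w ∈ stdSimplex ℝ ι) : ∑ j, ENNReal.ofReal (w j) = 1 := by
  rw [← ENNReal.ofReal_sum_of_nonneg fun j _ => hw.1 j, hw.2, ENNReal.ofReal_one]

lemma klIntegrand_mixture_le (hw : w ∈ stdSimplex ℝ ι) {a : ℝ} (ha : 0 ≤ a) {y : X}
    (hfs : ∀ j, 0 ≤ fs j y) :
    klIntegrand a (mixture w fs y) ≤ ∑ j, ENNReal.ofReal (w j) * klIntegrand a (fs j y) := by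
  rcases ha.eq_or_lt with rfl | ha
  · simp only [klIntegrand_zero_left, ofReal_mixture hw.1 hfs, le_refl]
  rcases (mixture_nonneg hw.1 hfs).eq_or_lt with hc | hc
  · obtain ⟨j, -, hwj⟩ : ∃ j ∈ Finset.univ, w j ≠ 0 :=
      Finset.exists_ne_zero_of_sum_ne_zero (by simp [hw.2])
    have hmul : w j * fs j y = 0 :=
      le_antisymm (hc ▸ mul_le_mixture hw.1 hfs j) (mul_nonneg (hw.1 j) (hfs j))
    have htop : ENNReal.ofReal (w j) * klIntegrand a (fs j y) = ⊤ := by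
      rw [(mul_eq_zero.1 hmul).resolve_left hwj, klIntegrand_zero_right ha.ne', ENNReal.mul_top]
      simpa using (hw.1 j).lt_of_ne' hwj
    exact le_top.trans_eq (ENNReal.sum_eq_top.2 ⟨j, Finset.mem_univ j, htop⟩).symm
  set c := mixture w fs y with hc_def
  have hW := sum_ofReal_of_mem_stdSimplex hw
  have hC := ofReal_mixture hw.1 hfs
  rw [← hc_def] at hC
  have htangent : klIntegrand a c + ENNReal.ofReal c + ENNReal.ofReal a ≤
      ∑ j, ENNReal.ofReal (w j) * klIntegrand a (fs j y) +
        ENNReal.ofReal (a / c) * ENNReal.ofReal c + ENNReal.ofReal c :=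
    calc klIntegrand a c + ENNReal.ofReal c + ENNReal.ofReal a
        = ∑ j, ENNReal.ofReal (w j) *
            (klIntegrand a c + ENNReal.ofReal (fs j y) + ENNReal.ofReal a) := by
          simp only [mul_add, Finset.sum_add_distrib, ← Finset.sum_mul, hW, one_mul, ← hC]
      _ ≤ ∑ j, ENNReal.ofReal (w j) * (klIntegrand a (fs j y) +
            ENNReal.ofReal (a / c) * ENNReal.ofReal (fs j y) + ENNReal.ofReal c) := by
          gcongr ∑ j, _ * ?_
          exact klIntegrand_add_le_tangent ha (hfs _) hc
      _ = _ := by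
          simp only [mul_add, Finset.sum_add_distrib, ← Finset.sum_mul, hW, one_mul,
            mul_left_comm _ (ENNReal.ofReal (a / c)), ← Finset.mul_sum, ← hC]
  rw [← ENNReal.ofReal_mul (by positivity), div_mul_cancel₀ a hc.ne', add_assoc, add_assoc,
    add_comm (ENNReal.ofReal c)] at htangent
  exact (ENNReal.add_le_add_iff_right (by finiteness)).1 htangent

end Mixture

section Density

variable {X : Type*} [MeasurableSpace X] {ν : Measure X} {f g : X → ℝ}

lemma law_apply_eq_zero_iff (hf : Measurable f) (s : Set X) :
    law ν f s = 0 ↔ ∀ᵐ x ∂ν, x ∈ s → f x ≤ 0 := by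
  rw [law, withDensity_apply_eq_zero hf.ennreal_ofReal, ae_iff]
  congr! 2
  ext x
  simp [and_comm]

lemma law_absolutelyContinuous_iff (hf : Measurable f) (hg : Measurable g) :
    law ν f ≪ law ν g ↔ ∀ᵐ x ∂ν, g x ≤ 0 → f x ≤ 0 := by
  refine ⟨fun h => (law_apply_eq_zero_iff hf {x | g x ≤ 0}).1 <|
    h <| (law_apply_eq_zero_iff hg _).2 <| ae_of_all _ fun _ => id, fun h s hs => ?_⟩
  rw [law_apply_eq_zero_iff hg] at hs
  rw [law_apply_eq_zero_iff hf]
  filter_upwards [h, hs] with x hx hxs using hx ∘ hxs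

lemma lintegral_law (hf : Measurable f) {h : X → ℝ≥0∞} (hh : Measurable h) :
    ∫⁻ x, h x ∂(law ν f) = ∫⁻ x, ENNReal.ofReal (f x) * h x ∂ν :=
  lintegral_withDensity_eq_lintegral_mul _ hf.ennreal_ofReal hh

namespace IsDensity

lemma isProbabilityMeasure_law (hf : IsDensity ν f) : IsProbabilityMeasure (law ν f) :=
  ⟨by simpa [law] using hf.lintegral_eq_one⟩

lemma law_absolutelyContinuous_iff (hf : IsDensity ν f) (hg : IsDensity ν g) :
    law ν f ≪ law ν g ↔ ∀ᵐ x ∂ν, g x = 0 → f x = 0 := by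
  simp only [DensityAggregation.law_absolutelyContinuous_iff hf.measurable hg.measurable,
    (hf.nonneg _).ge_iff_eq', (hg.nonneg _).ge_iff_eq']

lemma law_eq_withDensity_div (hf : IsDensity ν f) (hg : IsDensity ν g)
    (hfg : law ν f ≪ law ν g) :
    law ν f = (law ν g).withDensity fun x => ENNReal.ofReal (f x / g x) := by
  have hratio : Measurable fun x => ENNReal.ofReal (f x / g x) :=
    (hf.measurable.div hg.measurable).ennreal_ofReal
  rw [law, law, ← withDensity_mul _ hg.measurable.ennreal_ofReal hratio]
  refine withDensity_congr_ae ?_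
  filter_upwards [(hf.law_absolutelyContinuous_iff hg).1 hfg] with x hx
  rw [Pi.mul_apply, ← ENNReal.ofReal_mul (hg.nonneg x), mul_div_cancel_of_imp' hx]

lemma rnDeriv_law (hf : IsDensity ν f) (hg : IsDensity ν g) (hfg : law ν f ≪ law ν g) :
    (law ν f).rnDeriv (law ν g) =ᵐ[law ν g] fun x => ENNReal.ofReal (f x / g x) := by
  have := hg.isProbabilityMeasure_law
  rw [hf.law_eq_withDensity_div hg hfg]
  exact Measure.rnDeriv_withDensity _ (hf.measurable.div hg.measurable).ennreal_ofReal

theorem klLoss_eq_lintegral (hf : IsDensity ν f) (hg : IsDensity ν g) :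
    klLoss ν f g = ∫⁻ x, klIntegrand (f x) (g x) ∂ν := by
  have := hf.isProbabilityMeasure_law
  have := hg.isProbabilityMeasure_law
  by_cases hfg : law ν f ≪ law ν g
  · have hratio := hf.measurable.div hg.measurable
    calc klLoss ν f g
        = ∫⁻ x, ENNReal.ofReal (klFun ((law ν f).rnDeriv (law ν g) x).toReal) ∂(law ν g) :=
          klDiv_eq_lintegral_klFun_of_ac hfg
      _ = ∫⁻ x, ENNReal.ofReal (klFun (f x / g x)) ∂(law ν g) := by
          refine lintegral_congr_ae ?_
          filter_upwards [hf.rnDeriv_law hg hfg] with x hx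
          rw [hx, ENNReal.toReal_ofReal (div_nonneg (hf.nonneg x) (hg.nonneg x))]
      _ = ∫⁻ x, ENNReal.ofReal (g x) * ENNReal.ofReal (klFun (f x / g x)) ∂ν :=
          lintegral_law hg.measurable (measurable_klFun.comp hratio).ennreal_ofReal
      _ = ∫⁻ x, klIntegrand (f x) (g x) ∂ν := by
          refine lintegral_congr_ae ?_
          filter_upwards [(hf.law_absolutelyContinuous_iff hg).1 hfg] with x hx
          rw [klIntegrand, if_neg fun h => h.2 (hx h.1), ENNReal.ofReal_mul (hg.nonneg x)]
  · rw [klLoss, klDiv_of_not_ac hfg]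
    by_contra! hfin
    refine hfg ((hf.law_absolutelyContinuous_iff hg).2 ?_)
    filter_upwards [ae_lt_top (measurable_klIntegrand hf.measurable hg.measurable) hfin.symm]
      with x hx hgx
    by_contra hfx
    simp [hgx, klIntegrand_zero_right hfx] at hx

lemma klLoss_self (hf : IsDensity ν f) : klLoss ν f f = 0 := by
  have := hf.isProbabilityMeasure_law
  exact klDiv_self _

variable {ι : Type*} [Fintype ι] {w : ι → ℝ} {fs : ι → X → ℝ}

protected lemma mixture (hw : w ∈ stdSimplex ℝ ι) (hfs : ∀ j, IsDensity ν (fs j)) :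
    IsDensity ν (mixture w fs) where
  measurable := Finset.measurable_fun_sum _ fun j _ => (hfs j).measurable.const_mul _
  nonneg _ := mixture_nonneg hw.1 fun j => (hfs j).nonneg _
  lintegral_eq_one := by
    have hm := fun j => (hfs j).measurable.ennreal_ofReal
    simp_rw [ofReal_mixture hw.1 fun j => (hfs j).nonneg _]
    rw [lintegral_finsetSum _ fun j _ => (hm j).const_mul _]
    simp only [lintegral_const_mul _ (hm _), (hfs _).lintegral_eq_one, mul_one,
      sum_ofReal_of_mem_stdSimplex hw]

theorem klLoss_mixture_le (hf : IsDensity ν f) (hw : w ∈ stdSimplex ℝ ι)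
    (hfs : ∀ j, IsDensity ν (fs j)) :
    klLoss ν f (mixture w fs) ≤ ∑ j, ENNReal.ofReal (w j) * klLoss ν f (fs j) := by
  have hm := fun j => measurable_klIntegrand hf.measurable (hfs j).measurable
  calc klLoss ν f (mixture w fs)
      = ∫⁻ y, klIntegrand (f y) (mixture w fs y) ∂ν := hf.klLoss_eq_lintegral (.mixture hw hfs)
    _ ≤ ∫⁻ y, ∑ j, ENNReal.ofReal (w j) * klIntegrand (f y) (fs j y) ∂ν :=
        lintegral_mono fun y => klIntegrand_mixture_le hw (hf.nonneg y) fun j => (hfs j).nonneg y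
    _ = ∑ j, ENNReal.ofReal (w j) * klLoss ν f (fs j) := by
        rw [lintegral_finsetSum _ fun j _ => (hm j).const_mul _]
        simp only [lintegral_const_mul _ (hm _), hf.klLoss_eq_lintegral (hfs _)]

end IsDensity

lemma mixture_mem_densitiesBoundedBy {ι : Type*} [Fintype ι] {w : ι → ℝ} {fs : ι → X → ℝ} {A : ℝ}
    (hw : w ∈ stdSimplex ℝ ι) (hfs : ∀ j, fs j ∈ densitiesBoundedBy ν A) :
    mixture w fs ∈ densitiesBoundedBy ν A := by
  refine ⟨.mixture hw fun j => (hfs j).1, fun y => ?_⟩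
  calc mixture w fs y ≤ ∑ j, w j * A :=
        Finset.sum_le_sum fun j _ => mul_le_mul_of_nonneg_left ((hfs j).2 y) (hw.1 j)
    _ = A := by rw [← Finset.sum_mul, hw.2, one_mul]

lemma densitiesBoundedBy_mono {A A' : ℝ} (h : A ≤ A') :
    densitiesBoundedBy ν A ⊆ densitiesBoundedBy ν A' :=
  fun _ hf => ⟨hf.1, fun x => (hf.2 x).trans h⟩

end Density

section Bayes

/-- `-log w` for a weight `w ∈ [0, 1]`, with the value `∞` at `w = 0`. -/
def negLog (w : ℝ) : ℝ≥0∞ := if w = 0 then ⊤ else ENNReal.ofReal (-Real.log w)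

lemma measurable_negLog : Measurable negLog :=
  Measurable.ite (measurableSet_singleton 0) measurable_const (by fun_prop)

-- Both sides agree if `a`, `b` and `w` are positive.
lemma mul_negLog_add_klIntegrand_le {a b c w : ℝ} (ha : 0 ≤ a) (hb : 0 ≤ b)
    (hw : w ∈ Set.Icc 0 1) (hc : w * b ≤ c) :
    ENNReal.ofReal a * negLog (w * b / c) + klIntegrand a c + ENNReal.ofReal b ≤
      ENNReal.ofReal a * negLog w + klIntegrand a b + ENNReal.ofReal c := by
  obtain ⟨hw0, hw1⟩ := hw
  rcases ha.eq_or_lt with rfl | ha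
  · simp [klIntegrand_zero_left, add_comm]
  rcases hb.eq_or_lt with rfl | hb
  · simp [klIntegrand_zero_right ha.ne']
  rcases hw0.eq_or_lt with rfl | hw0
  · simp [negLog, ha]
  have hwb : 0 < w * b := mul_pos hw0 hb
  have hc0 : 0 < c := hwb.trans_le hc
  have hlog : 0 ≤ -Real.log w := neg_nonneg.2 (Real.log_nonpos hw0.le hw1)
  have hlog' : 0 ≤ -Real.log (w * b / c) :=
    neg_nonneg.2 (Real.log_nonpos (by positivity) ((div_le_one hc0).2 hc))
  have hac := mul_log_div_add_sub_nonneg ha.le hc0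
  have hab := mul_log_div_add_sub_nonneg ha.le hb
  rw [negLog, negLog, if_neg (by positivity), if_neg hw0.ne', klIntegrand_of_ne_zero a hb.ne',
    klIntegrand_of_ne_zero a hc0.ne', ← ENNReal.ofReal_mul ha.le, ← ENNReal.ofReal_mul ha.le,
    ← ENNReal.ofReal_add (by positivity) hac, ← ENNReal.ofReal_add (by positivity) hb.le,
    ← ENNReal.ofReal_add (by positivity) hab, ← ENNReal.ofReal_add (by positivity) hc0.le]
  refine ENNReal.ofReal_le_ofReal (le_of_eq ?_)
  rw [Real.log_div hwb.ne' hc0.ne', Real.log_mul hw0.ne' hb.ne', Real.log_div ha.ne' hc0.ne',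
    Real.log_div ha.ne' hb.ne']
  ring

variable {X : Type*} [MeasurableSpace X] {ν : Measure X} {f : X → ℝ}
  {ι : Type*} [Fintype ι] {w : ι → ℝ} {fs : ι → X → ℝ}

lemma measurable_posteriorWeight (hfs : ∀ j, Measurable (fs j)) (j : ι) :
    Measurable fun y => posteriorWeight w fs y j :=
  ((hfs j).const_mul _).div (Finset.measurable_fun_sum _ fun l _ => (hfs l).const_mul _)

namespace IsDensity

theorem lintegral_negLog_posteriorWeight_add_klLoss_mixture_le (hf : IsDensity ν f)
    (hw : w ∈ stdSimplex ℝ ι) (hfs : ∀ j, IsDensity ν (fs j)) (j : ι) :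
    ∫⁻ y, negLog (posteriorWeight w fs y j) ∂(law ν f) + klLoss ν f (mixture w fs) ≤
      negLog (w j) + klLoss ν f (fs j) := by
  have hmix : IsDensity ν (mixture w fs) := .mixture hw hfs
  have hpost : Measurable fun y => negLog (posteriorWeight w fs y j) :=
    measurable_negLog.comp <| measurable_posteriorWeight (fun j => (hfs j).measurable) j
  have hintegral : ∫⁻ y, (ENNReal.ofReal (f y) * negLog (posteriorWeight w fs y j) +
        klIntegrand (f y) (mixture w fs y) + ENNReal.ofReal (fs j y)) ∂ν ≤
      ∫⁻ y, (ENNReal.ofReal (f y) * negLog (w j) + klIntegrand (f y) (fs j y) +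
        ENNReal.ofReal (mixture w fs y)) ∂ν :=
    lintegral_mono fun y => mul_negLog_add_klIntegrand_le (hf.nonneg y) ((hfs j).nonneg y)
      (mem_Icc_of_mem_stdSimplex hw j) (mul_le_mixture hw.1 (fun l => (hfs l).nonneg y) j)
  rw [lintegral_add_right _ (hfs j).measurable.ennreal_ofReal,
    lintegral_add_right _ hmix.measurable.ennreal_ofReal,
    lintegral_add_right _ (measurable_klIntegrand hf.measurable hmix.measurable),
    lintegral_add_right _ (measurable_klIntegrand hf.measurable (hfs j).measurable),
    lintegral_mul_const _ hf.measurable.ennreal_ofReal, hf.lintegral_eq_one, one_mul,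
    (hfs j).lintegral_eq_one, hmix.lintegral_eq_one,
    ENNReal.add_le_add_iff_right ENNReal.one_ne_top, ← hf.klLoss_eq_lintegral hmix,
    ← hf.klLoss_eq_lintegral (hfs j)] at hintegral
  rwa [lintegral_law hf.measurable hpost]

lemma klLoss_mixture_le_negLog_add (hf : IsDensity ν f) (hw : w ∈ stdSimplex ℝ ι)
    (hfs : ∀ j, IsDensity ν (fs j)) (j : ι) :
    klLoss ν f (mixture w fs) ≤ negLog (w j) + klLoss ν f (fs j) :=
  le_add_self.trans (hf.lintegral_negLog_posteriorWeight_add_klLoss_mixture_le hw hfs j)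

end IsDensity

end Bayes

section Estimator

variable {X : Type*} [MeasurableSpace X] {ν : Measure X} {n : ℕ} {f : X → ℝ}

lemma IsDensity.isEstimator_const (hf : IsDensity ν f) :
    IsEstimator ν n fun _ => f where
  measurable := hf.measurable.comp measurable_snd
  isDensity _ := hf

namespace IsEstimator

lemma measurable_klLoss [SFinite ν] {fhat : (Fin n → X) → X → ℝ} (hfhat : IsEstimator ν n fhat)
    (hf : IsDensity ν f) : Measurable fun x => klLoss ν f (fhat x) := by
  simp_rw [fun x => hf.klLoss_eq_lintegral (hfhat.isDensity x)]
  exact Measurable.lintegral_prod_right' <|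
    measurable_klIntegrand (hf.measurable.comp measurable_snd) hfhat.measurable

variable {ι : Type*} [Fintype ι] {fhats : ι → (Fin n → X) → X → ℝ}

protected lemma mixture {w : (Fin n → X) → ι → ℝ} (hw : ∀ x, w x ∈ stdSimplex ℝ ι)
    (hwm : ∀ j, Measurable fun x => w x j) (hfhats : ∀ j, IsEstimator ν n (fhats j)) :
    IsEstimator ν n fun x => mixture (w x) fun j => fhats j x where
  measurable := Finset.measurable_fun_sum _ fun j _ =>
    ((hwm j).comp measurable_fst).mul (hfhats j).measurable
  isDensity x := .mixture (hw x) fun j => (hfhats j).isDensity x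

lemma klRisk_mixture_le [SFinite ν] (hfhats : ∀ j, IsEstimator ν n (fhats j))
    (hf : IsDensity ν f) {w : ι → ℝ} (hw : w ∈ stdSimplex ℝ ι) :
    klRisk ν (fun x => mixture w fun j => fhats j x) f ≤
      ∑ j, ENNReal.ofReal (w j) * klRisk ν (fhats j) f := by
  have hm := fun j => (hfhats j).measurable_klLoss hf
  calc klRisk ν (fun x => mixture w fun j => fhats j x) f
      ≤ ∫⁻ x, ∑ j, ENNReal.ofReal (w j) * klLoss ν f (fhats j x)
          ∂(Measure.pi fun _ => law ν f) :=
        lintegral_mono fun x => hf.klLoss_mixture_le hw fun j => (hfhats j).isDensity x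
    _ = ∑ j, ENNReal.ofReal (w j) * klRisk ν (fhats j) f := by
        rw [lintegral_finsetSum _ fun j _ => (hm j).const_mul _]
        simp only [lintegral_const_mul _ (hm _), klRisk]

end IsEstimator

lemma excessRisk_le_of_forall_klRisk_le {M : ℕ} [NeZero M] {fs : Fin M → X → ℝ}
    {fhat : (Fin n → X) → X → ℝ} {r : ℝ} (hr : 0 ≤ r)
    (h : ∀ j, klRisk ν fhat f ≤ ENNReal.ofReal r + klLoss ν f (fs j)) :
    excessRisk ν fs fhat f ≤ r := by
  have hmin : klRisk ν fhat f ≤ ENNReal.ofReal r + ⨅ j, klLoss ν f (fs j) := by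
    rw [ENNReal.add_iInf]
    exact le_iInf h
  have hmin' := EReal.coe_ennreal_le_coe_ennreal_iff.2 hmin
  rw [EReal.coe_ennreal_add, EReal.coe_ennreal_ofReal, max_eq_left hr] at hmin'
  exact EReal.sub_le_of_le_add hmin'

lemma AttainsUpperBound.mono {F₀ F : Set (X → ℝ)} {M : ℕ} {fs : Fin M → X → ℝ}
    {fhat : (Fin n → X) → X → ℝ} {r s : ℝ} (h : AttainsUpperBound ν F₀ F fs fhat r)
    (hrs : r ≤ s) : AttainsUpperBound ν F₀ F fs fhat s :=
  ⟨h.1, h.2.1, h.2.2.trans (EReal.coe_le_coe_iff.2 hrs)⟩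

end Estimator

section Likelihood

variable {X : Type*} {M n : ℕ} {fs : Fin M → X → ℝ}

lemma likelihood_nonneg {g : X → ℝ} (hg : ∀ y, 0 ≤ g y) (x : Fin n → X) (k : ℕ) :
    0 ≤ likelihood g x k :=
  Finset.prod_nonneg fun _ _ => hg _

lemma likelihood_zero (g : X → ℝ) (x : Fin n → X) : likelihood g x 0 = 1 := by
  simp [likelihood]

lemma likelihood_update (g : X → ℝ) (x : Fin n → X) (i : Fin n) (y : X) :
    likelihood g (Function.update x i y) i = likelihood g x i := by
  refine Finset.prod_congr rfl fun l hl => ?_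
  rw [Function.update_of_ne (Fin.lt_def.2 (Finset.mem_filter.1 hl).2).ne]

lemma likelihood_succ (g : X → ℝ) (x : Fin n → X) (i : Fin n) :
    likelihood g x (i + 1) = likelihood g x i * g (x i) := by
  have hfilter : Finset.univ.filter (fun l : Fin n => l.val < i + 1) =
      insert i (Finset.univ.filter fun l : Fin n => l.val < i) := by
    grind
  rw [likelihood, hfilter, Finset.prod_insert (by simp), mul_comm, likelihood]

lemma weight_mem_stdSimplex [NeZero M] (hfs : ∀ j y, 0 ≤ fs j y) (x : Fin n → X) (k : ℕ) :
    weight fs x k ∈ stdSimplex ℝ (Fin M) := by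
  have hL := fun l => likelihood_nonneg (hfs l) x k
  by_cases h : ∑ l, likelihood (fs l) x k = 0
  · refine ⟨fun j => ?_, ?_⟩ <;> simp [weight, h]
  · refine ⟨fun j => ?_, ?_⟩
    · rw [weight, if_neg h]
      exact div_nonneg (hL j) (Finset.sum_nonneg fun l _ => hL l)
    · simp [weight, h, ← Finset.sum_div]

/-- The share of `f_j` in the total likelihood of the first `k` observations. Unlike `weight`, it
is `0` if all the likelihoods vanish, so that its `negLog` is `∞` once a data point rules out all
the functions. -/
def likelihoodShare (fs : Fin M → X → ℝ) (x : Fin n → X) (k : ℕ) (j : Fin M) : ℝ :=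
  likelihood (fs j) x k / ∑ l, likelihood (fs l) x k

lemma negLog_likelihoodShare_zero (fs : Fin M → X → ℝ) (x : Fin n → X) (j : Fin M) :
    negLog (likelihoodShare fs x 0 j) = ENNReal.ofReal (Real.log M) := by
  have := j.pos.ne'
  simp [negLog, likelihoodShare, likelihood_zero, this]

lemma negLog_likelihoodShare_of_sum_eq_zero {x : Fin n → X} {k : ℕ}
    (h : ∑ l, likelihood (fs l) x k = 0) (j : Fin M) : negLog (likelihoodShare fs x k j) = ⊤ := by
  simp [negLog, likelihoodShare, h]

lemma negLog_weight_le (fs : Fin M → X → ℝ) (x : Fin n → X) (k : ℕ) (j : Fin M) :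
    negLog (weight fs x k j) ≤ negLog (likelihoodShare fs x k j) := by
  by_cases h : ∑ l, likelihood (fs l) x k = 0
  · simp only [negLog_likelihoodShare_of_sum_eq_zero h, le_top]
  · rw [weight, if_neg h, likelihoodShare]

lemma likelihoodShare_update_succ {x : Fin n → X} {i : Fin n}
    (h : ∑ l, likelihood (fs l) x i ≠ 0) (y : X) (j : Fin M) :
    likelihoodShare fs (Function.update x i y) (i + 1) j =
      posteriorWeight (weight fs x i) fs y j := by
  simp only [likelihoodShare, likelihood_succ, likelihood_update, Function.update_self,
    posteriorWeight, mixture, weight, if_neg h, div_mul_eq_mul_div, ← Finset.sum_div,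
    div_div_div_cancel_right₀ h]

variable [MeasurableSpace X]

lemma measurable_likelihood {g : X → ℝ} (hg : Measurable g) (k : ℕ) :
    Measurable fun x : Fin n → X => likelihood g x k :=
  Finset.measurable_fun_prod _ fun i _ => hg.comp (measurable_pi_apply i)

lemma measurable_likelihoodShare (hfs : ∀ j, Measurable (fs j)) (k : ℕ) (j : Fin M) :
    Measurable fun x : Fin n → X => likelihoodShare fs x k j :=
  (measurable_likelihood (hfs j) k).div <|
    Finset.measurable_fun_sum _ fun l _ => measurable_likelihood (hfs l) k

lemma measurable_weight (hfs : ∀ j, Measurable (fs j)) (k : ℕ) (j : Fin M) :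
    Measurable fun x : Fin n → X => weight fs x k j :=
  Measurable.ite
    (Finset.measurable_fun_sum _ (fun l _ => measurable_likelihood (hfs l) k)
      (measurableSet_singleton 0))
    measurable_const (measurable_likelihoodShare hfs k j)

end Likelihood

section ProgressiveMixture

variable {X : Type*} {M n : ℕ} {fs : Fin M → X → ℝ}

/-- The aggregate `∑_j w_j^{(k)} f_j` with exponential weights after `k` observations. -/
def exponentialMixture (fs : Fin M → X → ℝ) (k : ℕ) (x : Fin n → X) : X → ℝ :=
  mixture (weight fs x k) fs

lemma progressiveMixture_eq_mixture (fs : Fin M → X → ℝ) (x : Fin n → X) :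
    progressiveMixture M n fs x =
      mixture (fun _ : Fin (n + 1) => ((n : ℝ) + 1)⁻¹) fun k => exponentialMixture fs k x := by
  ext y
  simp only [progressiveMixture, averagedWeight, exponentialMixture, mixture, Finset.mul_sum,
    Finset.sum_mul, mul_assoc, ← Fin.sum_univ_eq_sum_range fun k =>
      ((n : ℝ) + 1)⁻¹ * (weight fs x k _ * fs _ y)]
  exact Finset.sum_comm

lemma const_inv_mem_stdSimplex (n : ℕ) :
    (fun _ => ((n : ℝ) + 1)⁻¹) ∈ stdSimplex ℝ (Fin (n + 1)) :=
  ⟨fun _ => by positivity, by simp [mul_inv_cancel₀ (n.cast_add_one_ne_zero (R := ℝ))]⟩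

variable [MeasurableSpace X] {ν : Measure X} {f : X → ℝ}

lemma isEstimator_exponentialMixture [NeZero M] (hfs : ∀ j, IsDensity ν (fs j)) (k : ℕ) :
    IsEstimator ν n (exponentialMixture fs k) :=
  .mixture (weight_mem_stdSimplex (fun j => (hfs j).nonneg) · k)
    (measurable_weight (fun j => (hfs j).measurable) k) fun j => (hfs j).isEstimator_const

lemma isEstimator_progressiveMixture [NeZero M] (hfs : ∀ j, IsDensity ν (fs j)) :
    IsEstimator ν n (progressiveMixture M n fs) := by
  simp only [funext (progressiveMixture_eq_mixture fs)]
  exact .mixture (fun _ => const_inv_mem_stdSimplex n) (fun _ => measurable_const)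
    fun k => isEstimator_exponentialMixture hfs k

lemma progressiveMixture_mem_densitiesBoundedBy [NeZero M] {A : ℝ}
    (hfs : ∀ j, fs j ∈ densitiesBoundedBy ν A) (x : Fin n → X) :
    progressiveMixture M n fs x ∈ densitiesBoundedBy ν A := by
  rw [progressiveMixture_eq_mixture]
  exact mixture_mem_densitiesBoundedBy (const_inv_mem_stdSimplex n) fun k =>
    mixture_mem_densitiesBoundedBy (weight_mem_stdSimplex (fun j => (hfs j).1.nonneg) x k) hfs

/-- The expectation under `f` of the loss `-log` of the share of `f_j` in the likelihood of the
first `k` observations: the potential of the regret bound. -/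
def expectedPotential (ν : Measure X) (n : ℕ) (fs : Fin M → X → ℝ) (f : X → ℝ) (j : Fin M)
    (k : ℕ) : ℝ≥0∞ :=
  ∫⁻ x : Fin n → X, negLog (likelihoodShare fs x k j) ∂(Measure.pi fun _ => law ν f)

lemma lintegral_pi_eq_lintegral_lintegral_update (μ : Measure X) [IsProbabilityMeasure μ]
    {F : (Fin n → X) → ℝ≥0∞} (hF : Measurable F) (i : Fin n) :
    ∫⁻ x, F x ∂(Measure.pi fun _ => μ) =
      ∫⁻ x, ∫⁻ y, F (Function.update x i y) ∂μ ∂(Measure.pi fun _ => μ) := by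
  have hG : Measurable fun x => ∫⁻ y, F (Function.update x i y) ∂μ := by
    simpa only [lmarginal_singleton] using hF.lmarginal (fun _ => μ) (s := {i})
  refine lintegral_eq_of_lmarginal_eq {i} hF hG ?_
  ext x
  simp [lmarginal_singleton]

section

variable [NeZero M] (hf : IsDensity ν f) (hfs : ∀ j, IsDensity ν (fs j)) (j : Fin M)
include hf hfs

lemma lintegral_negLog_likelihoodShare_update_add_klLoss_le (x : Fin n → X) (i : Fin n) :
    ∫⁻ y, negLog (likelihoodShare fs (Function.update x i y) (i + 1) j) ∂(law ν f) +
        klLoss ν f (exponentialMixture fs i x) ≤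
      negLog (likelihoodShare fs x i j) + klLoss ν f (fs j) := by
  by_cases h : ∑ l, likelihood (fs l) x i = 0
  · simp [negLog_likelihoodShare_of_sum_eq_zero h]
  simp only [likelihoodShare_update_succ h]
  grw [← negLog_weight_le]
  exact hf.lintegral_negLog_posteriorWeight_add_klLoss_mixture_le
    (weight_mem_stdSimplex (fun j => (hfs j).nonneg) x i) hfs j

lemma klRisk_exponentialMixture_le (k : ℕ) :
    klRisk (n := n) ν (exponentialMixture fs k) f ≤
      expectedPotential ν n fs f j k + klLoss ν f (fs j) := by
  have := hf.isProbabilityMeasure_law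
  calc klRisk ν (exponentialMixture fs k) f
      ≤ ∫⁻ x : Fin n → X, (negLog (likelihoodShare fs x k j) + klLoss ν f (fs j))
          ∂(Measure.pi fun _ => law ν f) := by
        refine lintegral_mono fun x => ?_
        grw [← negLog_weight_le]
        exact hf.klLoss_mixture_le_negLog_add
          (weight_mem_stdSimplex (fun j => (hfs j).nonneg) x k) hfs j
    _ = expectedPotential ν n fs f j k + klLoss ν f (fs j) := by
        simp [lintegral_add_right _ measurable_const, expectedPotential]

variable [SFinite ν]

lemma expectedPotential_succ_add_klRisk_le {k : ℕ} (hk : k < n) :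
    expectedPotential ν n fs f j (k + 1) + klRisk (n := n) ν (exponentialMixture fs k) f ≤
      expectedPotential ν n fs f j k + klLoss ν f (fs j) := by
  have := hf.isProbabilityMeasure_law
  have hm : Measurable fun x : Fin n → X => negLog (likelihoodShare fs x (k + 1) j) :=
    measurable_negLog.comp <| measurable_likelihoodShare (fun j => (hfs j).measurable) _ j
  rw [expectedPotential, lintegral_pi_eq_lintegral_lintegral_update (law ν f) hm ⟨k, hk⟩, klRisk,
    ← lintegral_add_right _ ((isEstimator_exponentialMixture hfs k).measurable_klLoss hf)]
  calc _ ≤ ∫⁻ x : Fin n → X, (negLog (likelihoodShare fs x k j) + klLoss ν f (fs j))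
          ∂(Measure.pi fun _ => law ν f) :=
        lintegral_mono fun x =>
          lintegral_negLog_likelihoodShare_update_add_klLoss_le hf hfs j x ⟨k, hk⟩
    _ = expectedPotential ν n fs f j k + klLoss ν f (fs j) := by
        simp [lintegral_add_right _ measurable_const, expectedPotential]

lemma expectedPotential_add_sum_klRisk_le {k : ℕ} (hk : k ≤ n) :
    expectedPotential ν n fs f j k +
        ∑ i ∈ Finset.range k, klRisk (n := n) ν (exponentialMixture fs i) f ≤
      ENNReal.ofReal (Real.log M) + k * klLoss ν f (fs j) := by
  have := hf.isProbabilityMeasure_law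
  induction k with
  | zero => simp [expectedPotential, negLog_likelihoodShare_zero]
  | succ k ih =>
    calc _ = expectedPotential ν n fs f j (k + 1) +
          klRisk (n := n) ν (exponentialMixture fs k) f +
            ∑ i ∈ Finset.range k, klRisk (n := n) ν (exponentialMixture fs i) f := by
          rw [Finset.sum_range_succ]
          ring
      _ ≤ expectedPotential ν n fs f j k + klLoss ν f (fs j) +
            ∑ i ∈ Finset.range k, klRisk (n := n) ν (exponentialMixture fs i) f := by
          grw [expectedPotential_succ_add_klRisk_le hf hfs j hk]
      _ = expectedPotential ν n fs f j k +
            ∑ i ∈ Finset.range k, klRisk (n := n) ν (exponentialMixture fs i) f +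
              klLoss ν f (fs j) := add_right_comm _ _ _
      _ ≤ ENNReal.ofReal (Real.log M) + k * klLoss ν f (fs j) + klLoss ν f (fs j) := by
          grw [ih (Nat.le_of_succ_le hk)]
      _ = _ := by
          push_cast
          ring

lemma sum_klRisk_exponentialMixture_le :
    ∑ k ∈ Finset.range (n + 1), klRisk (n := n) ν (exponentialMixture fs k) f ≤
      ENNReal.ofReal (Real.log M) + (n + 1) * klLoss ν f (fs j) := by
  rw [Finset.sum_range_succ]
  grw [klRisk_exponentialMixture_le hf hfs j n]
  rw [← add_assoc, add_comm (Finset.sum _ _)]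
  grw [expectedPotential_add_sum_klRisk_le hf hfs j le_rfl]
  exact le_of_eq (by ring)

theorem klRisk_progressiveMixture_le :
    klRisk ν (progressiveMixture M n fs) f ≤
      ENNReal.ofReal (Real.log M / (n + 1)) + klLoss ν f (fs j) := by
  have hpos : (0 : ℝ) < n + 1 := n.cast_add_one_pos
  calc klRisk ν (progressiveMixture M n fs) f
      ≤ ∑ k : Fin (n + 1), ENNReal.ofReal ((n : ℝ) + 1)⁻¹ *
          klRisk (n := n) ν (exponentialMixture fs k) f := by
        simp only [funext (progressiveMixture_eq_mixture fs)]
        exact IsEstimator.klRisk_mixture_le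
          (fhats := fun k : Fin (n + 1) => exponentialMixture (n := n) fs k)
          (fun k => isEstimator_exponentialMixture hfs k) hf (const_inv_mem_stdSimplex n)
    _ = ENNReal.ofReal ((n : ℝ) + 1)⁻¹ *
          ∑ k ∈ Finset.range (n + 1), klRisk (n := n) ν (exponentialMixture fs k) f := by
        rw [← Finset.mul_sum, ← Fin.sum_univ_eq_sum_range]
    _ ≤ ENNReal.ofReal ((n : ℝ) + 1)⁻¹ *
          (ENNReal.ofReal (Real.log M) + (n + 1) * klLoss ν f (fs j)) := by
        grw [sum_klRisk_exponentialMixture_le hf hfs j]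
    _ = ENNReal.ofReal (Real.log M / (n + 1)) + klLoss ν f (fs j) := by
        have hcancel : ENNReal.ofReal ((n : ℝ) + 1)⁻¹ * (n + 1) = 1 := by
          rw [ENNReal.ofReal_inv_of_pos hpos]
          norm_cast
          exact ENNReal.inv_mul_cancel (by simp) (by simp)
        rw [mul_add, ← mul_assoc, hcancel, one_mul, ← ENNReal.ofReal_mul (by positivity),
          inv_mul_eq_div]

end

theorem attainsUpperBound_progressiveMixture [NeZero M] [SFinite ν] {A : ℝ} {F : Set (X → ℝ)}
    (hF : ∀ f ∈ F, IsDensity ν f) (hfs : ∀ j, fs j ∈ densitiesBoundedBy ν A) :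
    AttainsUpperBound ν (densitiesBoundedBy ν A) F fs (progressiveMixture M n fs)
      (Real.log M / (n + 1)) :=
  ⟨isEstimator_progressiveMixture fun j => (hfs j).1,
    progressiveMixture_mem_densitiesBoundedBy hfs,
    iSup₂_le fun f hf => excessRisk_le_of_forall_klRisk_le (by positivity)
      fun j => klRisk_progressiveMixture_le (hF f hf) (fun l => (hfs l).1) j⟩

end ProgressiveMixture

section Needle

variable {X : Type*} {S T : Set X} {δ : ℝ}

/-- The function that is `1 - δ` on `S` and `δ` on `T`, for disjoint sets `S` and `T`. As a mixture
of two uniform densities it is a density if both sets have measure `1`. -/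
def needleDensity (S T : Set X) (δ : ℝ) : X → ℝ :=
  mixture ![1 - δ, δ] ![S.indicator 1, T.indicator 1]

lemma needleDensity_apply (S T : Set X) (δ : ℝ) (x : X) :
    needleDensity S T δ x = (1 - δ) * S.indicator 1 x + δ * T.indicator 1 x := by
  simp [needleDensity, mixture, Fin.sum_univ_two]

lemma needleDensity_of_mem_left (hST : Disjoint S T) (δ : ℝ) {x : X} (hx : x ∈ S) :
    needleDensity S T δ x = 1 - δ := by
  simp [needleDensity_apply, hx, hST.notMem_of_mem_left hx]

lemma needleDensity_of_notMem_left (T : Set X) (δ : ℝ) {x : X} (hx : x ∉ S) :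
    needleDensity S T δ x = δ * T.indicator 1 x := by
  simp [needleDensity_apply, hx]

variable [MeasurableSpace X] {ν : Measure X}

lemma indicator_one_mem_densitiesBoundedBy (hS : MeasurableSet S) (hν : ν S = 1) :
    S.indicator 1 ∈ densitiesBoundedBy ν 1 := by
  refine ⟨⟨measurable_one.indicator hS, Set.indicator_nonneg fun _ _ => zero_le_one, ?_⟩,
    Set.indicator_le_self' fun _ _ => zero_le_one⟩
  have hind : ∀ x, ENNReal.ofReal (S.indicator 1 x) = S.indicator 1 x := fun x => by
    by_cases hx : x ∈ S <;> simp [hx]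
  simp_rw [hind, lintegral_indicator_one hS, hν]

lemma needleDensity_mem_densitiesBoundedBy (hS : MeasurableSet S) (hT : MeasurableSet T)
    (hνS : ν S = 1) (hνT : ν T = 1) (hδ : δ ∈ Set.Icc 0 1) :
    needleDensity S T δ ∈ densitiesBoundedBy ν 1 :=
  mixture_mem_densitiesBoundedBy
    ⟨Fin.forall_fin_two.2 ⟨sub_nonneg.2 hδ.2, hδ.1⟩, by simp [Fin.sum_univ_two]⟩
    (Fin.forall_fin_two.2 ⟨indicator_one_mem_densitiesBoundedBy hS hνS,
      indicator_one_mem_densitiesBoundedBy hT hνT⟩)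

lemma law_needleDensity_restrict (hS : MeasurableSet S) (hST : Disjoint S T) (δ : ℝ) :
    (law ν (needleDensity S T δ)).restrict S = ENNReal.ofReal (1 - δ) • ν.restrict S := by
  rw [law, restrict_withDensity hS, ← withDensity_const]
  refine withDensity_congr_ae ((ae_restrict_iff' hS).2 (ae_of_all _ fun x hx => ?_))
  simp only [needleDensity_of_mem_left hST δ hx]

end Needle

section LowerBound

lemma ofReal_mul_log_one_add_le {a b t : ℝ} (ha : 0 ≤ a) (hb : 0 ≤ b) (ht : 0 ≤ t) :
    ENNReal.ofReal (a * Real.log (1 + t)) ≤ klIntegrand a b + ENNReal.ofReal (t * b) := by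
  rcases ha.eq_or_lt with rfl | ha
  · simp
  rcases hb.eq_or_lt with rfl | hb
  · simp [klIntegrand_zero_right ha.ne']
  rw [klIntegrand_of_ne_zero a hb.ne',
    ← ENNReal.ofReal_add (mul_log_div_add_sub_nonneg ha.le hb) (by positivity)]
  refine ENNReal.ofReal_le_ofReal ?_
  have hnonneg := mul_log_div_add_sub_nonneg ha.le (mul_pos (by positivity : 0 < 1 + t) hb)
  rw [mul_comm (1 + t), ← div_div, Real.log_div (by positivity) (by positivity)] at hnonneg
  linear_combination hnonneg

variable {ι : Type*} [Fintype ι] {δ : ℝ}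

lemma ofReal_mul_log_card_le_sum_klIntegrand [DecidableEq ι] (hδ : 0 ≤ δ) {b : ℝ} (hb : 0 ≤ b)
    (j : ι) :
    ENNReal.ofReal (δ * Real.log (Fintype.card ι)) ≤
      ∑ i, klIntegrand (Pi.single (M := fun _ => ℝ) j δ i) b := by
  have hcard : 1 + ((Finset.univ.erase j).card : ℝ) = Fintype.card ι := by
    exact_mod_cast add_comm 1 _ ▸ Finset.card_erase_add_one (Finset.mem_univ j)
  have hsum : ∑ i ∈ Finset.univ.erase j, klIntegrand (Pi.single (M := fun _ => ℝ) j δ i) b =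
      ENNReal.ofReal ((Finset.univ.erase j).card * b) := by
    rw [Finset.sum_congr rfl fun i hi => by
        rw [Pi.single_eq_of_ne (Finset.ne_of_mem_erase hi), klIntegrand_zero_left],
      Finset.sum_const, ← ENNReal.ofReal_nsmul, nsmul_eq_mul]
  rw [← Finset.add_sum_erase _ _ (Finset.mem_univ j), hsum, Pi.single_eq_same, ← hcard]
  exact ofReal_mul_log_one_add_le hδ hb (Nat.cast_nonneg _)

variable {X : Type*} [MeasurableSpace X] {ν : Measure X} {S : Set X} {T : ι → Set X}
  (hS : MeasurableSet S) (hT : ∀ i, MeasurableSet (T i)) (hνS : ν S = 1) (hνT : ∀ i, ν (T i) = 1)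
  (hST : ∀ i, Disjoint S (T i)) (hTT : Pairwise (Function.onFun Disjoint T))
  (hδ : δ ∈ Set.Icc 0 1)
include hS hT hνS hνT hST hTT hδ

theorem card_mul_ofReal_le_sum_klLoss_needleDensity {g : X → ℝ} (hg : IsDensity ν g) :
    Fintype.card ι * ENNReal.ofReal (δ * Real.log (Fintype.card ι)) ≤
      ∑ i, klLoss ν (needleDensity S (T i) δ) g := by
  classical
  have hf := fun i => (needleDensity_mem_densitiesBoundedBy hS (hT i) hνS (hνT i) hδ).1
  have hneedle : ∀ j, ∀ x ∈ T j, ∀ i,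
      needleDensity S (T i) δ x = Pi.single (M := fun _ => ℝ) j δ i := by
    intro j x hx i
    rw [needleDensity_of_notMem_left _ _ ((hST j).notMem_of_mem_right hx)]
    rcases eq_or_ne i j with rfl | hij
    · simp [hx]
    · simp [hij, (hTT hij).notMem_of_mem_right hx]
  calc (Fintype.card ι : ℝ≥0∞) * ENNReal.ofReal (δ * Real.log (Fintype.card ι))
      = ∑ j, ∫⁻ _ in T j, ENNReal.ofReal (δ * Real.log (Fintype.card ι)) ∂ν := by simp [hνT]
    _ ≤ ∑ j, ∫⁻ x in T j, ∑ i, klIntegrand (needleDensity S (T i) δ x) (g x) ∂ν := by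
        refine Finset.sum_le_sum fun j _ => setLIntegral_mono' (hT j) fun x hx => ?_
        simp only [hneedle j x hx]
        exact ofReal_mul_log_card_le_sum_klIntegrand hδ.1 (hg.nonneg x) j
    _ = ∫⁻ x in ⋃ j, T j, ∑ i, klIntegrand (needleDensity S (T i) δ x) (g x) ∂ν := by
        rw [lintegral_iUnion hT hTT, tsum_fintype]
    _ ≤ ∫⁻ x, ∑ i, klIntegrand (needleDensity S (T i) δ x) (g x) ∂ν := setLIntegral_le_lintegral _ _
    _ = ∑ i, klLoss ν (needleDensity S (T i) δ) g := by
        rw [lintegral_finsetSum _ fun i _ => measurable_klIntegrand (hf i).measurable hg.measurable]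
        simp only [(hf _).klLoss_eq_lintegral hg]

theorem card_mul_ofReal_le_sum_klRisk_needleDensity [SFinite ν] {n : ℕ}
    {fhat : (Fin n → X) → X → ℝ} (hfhat : IsEstimator ν n fhat) :
    Fintype.card ι * ENNReal.ofReal ((1 - δ) ^ n * (δ * Real.log (Fintype.card ι))) ≤
      ∑ i, klRisk ν fhat (needleDensity S (T i) δ) := by
  have hf := fun i => (needleDensity_mem_densitiesBoundedBy hS (hT i) hνS (hνT i) hδ).1
  have hδ' := sub_nonneg.2 hδ.2
  have : IsFiniteMeasure (ν.restrict S) := ⟨by simp [hνS]⟩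
  set κ : Measure X := ENNReal.ofReal (1 - δ) • ν.restrict S with hκ
  have : IsFiniteMeasure κ := Measure.smul_finite _ ENNReal.ofReal_ne_top
  have hle : ∀ i, Measure.pi (fun _ : Fin n => κ) ≤
      Measure.pi fun _ => law ν (needleDensity S (T i) δ) := fun i => by
    have := (hf i).isProbabilityMeasure_law
    rw [hκ, ← law_needleDensity_restrict hS (hST i) δ, ← Measure.restrict_pi_pi]
    exact Measure.restrict_le_self
  calc Fintype.card ι * ENNReal.ofReal ((1 - δ) ^ n * (δ * Real.log (Fintype.card ι)))
      = ∫⁻ _, Fintype.card ι * ENNReal.ofReal (δ * Real.log (Fintype.card ι))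
          ∂(Measure.pi fun _ : Fin n => κ) := by
        simp only [lintegral_const, Measure.pi_univ, hκ, Measure.smul_apply, smul_eq_mul,
          Measure.restrict_apply_univ, hνS, mul_one, Finset.prod_const, Finset.card_univ,
          Fintype.card_fin, ENNReal.ofReal_mul (pow_nonneg hδ' n), ENNReal.ofReal_pow hδ']
        ring
    _ ≤ ∫⁻ x, ∑ i, klLoss ν (needleDensity S (T i) δ) (fhat x)
          ∂(Measure.pi fun _ : Fin n => κ) :=
        lintegral_mono fun x => card_mul_ofReal_le_sum_klLoss_needleDensity hS hT hνS hνT hST hTT hδ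
          (hfhat.isDensity x)
    _ = ∑ i, ∫⁻ x, klLoss ν (needleDensity S (T i) δ) (fhat x)
          ∂(Measure.pi fun _ : Fin n => κ) :=
        lintegral_finsetSum _ fun i _ => hfhat.measurable_klLoss (hf i)
    _ ≤ ∑ i, klRisk ν fhat (needleDensity S (T i) δ) :=
        Finset.sum_le_sum fun i _ => lintegral_mono' (hle i) le_rfl

lemma exists_ofReal_le_klRisk_needleDensity [Nonempty ι] [SFinite ν] {n : ℕ}
    {fhat : (Fin n → X) → X → ℝ} (hfhat : IsEstimator ν n fhat) :
    ∃ i, ENNReal.ofReal ((1 - δ) ^ n * (δ * Real.log (Fintype.card ι))) ≤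
      klRisk ν fhat (needleDensity S (T i) δ) := by
  have hsum : ∑ _i : ι, ENNReal.ofReal ((1 - δ) ^ n * (δ * Real.log (Fintype.card ι))) ≤
      ∑ i, klRisk ν fhat (needleDensity S (T i) δ) := by
    simpa using card_mul_ofReal_le_sum_klRisk_needleDensity hS hT hνS hνT hST hTT hδ hfhat
  obtain ⟨i, -, hi⟩ := ENNReal.exists_le_of_sum_le Finset.univ_nonempty hsum
  exact ⟨i, hi⟩

omit hS hT hνS hνT hST hTT hδ

lemma exp_neg_one_le_one_sub_inv_pow (n : ℕ) : Real.exp (-1) ≤ (1 - ((n : ℝ) + 1)⁻¹) ^ n := by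
  rcases n.eq_zero_or_pos with rfl | hn
  · simp
  have hn' : (0 : ℝ) < n := Nat.cast_pos.2 hn
  have hpos : 0 < 1 - ((n : ℝ) + 1)⁻¹ := sub_pos.2 (inv_lt_one_of_one_lt₀ (by linarith))
  have hlog := Real.one_sub_inv_le_log_of_pos hpos
  rw [← Real.le_log_iff_exp_le (by positivity), Real.log_pow]
  calc (-1 : ℝ) = n * (1 - (1 - ((n : ℝ) + 1)⁻¹)⁻¹) := by
        have : (n : ℝ) + 1 - 1 ≠ 0 := by simpa using hn'.ne'
        field_simp
        ring
    _ ≤ n * Real.log (1 - ((n : ℝ) + 1)⁻¹) := by gcongr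

theorem lowerBound_of_disjoint [SFinite ν] {B : ℕ → Set X} (hB : ∀ k, MeasurableSet (B k))
    (hν : ∀ k, ν (B k) = 1) (hd : Pairwise (Function.onFun Disjoint B)) {A : ℝ} (hA : 1 ≤ A)
    (range : ℕ → ℕ → Prop) :
    LowerBound ν (densitiesBoundedBy ν A) (densitiesBoundedBy ν A) range
      (fun M n => Real.log M / n) (Real.exp (-1) / 2) := by
  intro M n hM hn _
  have : NeZero M := ⟨by omega⟩
  have hn' : (1 : ℝ) ≤ n := Nat.one_le_cast.2 hn
  set δ : ℝ := ((n : ℝ) + 1)⁻¹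
  have hδ : δ ∈ Set.Icc 0 1 := ⟨by positivity, inv_le_one_of_one_le₀ (by linarith)⟩
  set fs : Fin M → X → ℝ := fun j => needleDensity (B 0) (B (j + 1)) δ
  have hfs : ∀ j, fs j ∈ densitiesBoundedBy ν A := fun j => densitiesBoundedBy_mono hA <|
    needleDensity_mem_densitiesBoundedBy (hB _) (hB _) (hν _) (hν _) hδ
  refine ⟨fs, hfs, fun fhat hfhat => ?_⟩
  obtain ⟨j, hj⟩ := exists_ofReal_le_klRisk_needleDensity (hB 0) (fun j : Fin M => hB (j + 1))
    (hν 0) (fun j => hν (j + 1)) (fun j => hd (by omega)) (fun i j hij => hd (by omega)) hδ hfhat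
  have hmin : ⨅ i, klLoss ν (fs j) (fs i) = 0 :=
    le_antisymm ((iInf_le _ j).trans (hfs j).1.klLoss_self.le) zero_le
  have hδ_ge : (2 * (n : ℝ))⁻¹ ≤ δ := inv_anti₀ (by positivity) (by linarith)
  have hpow : 0 ≤ (1 - δ) ^ n := pow_nonneg (sub_nonneg.2 hδ.2) n
  have hrate : Real.exp (-1) / 2 * (Real.log M / n) ≤ (1 - δ) ^ n * (δ * Real.log M) :=
    calc Real.exp (-1) / 2 * (Real.log M / n)
        = Real.exp (-1) * ((2 * (n : ℝ))⁻¹ * Real.log M) := by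
          field_simp
      _ ≤ (1 - δ) ^ n * (δ * Real.log M) := by
          gcongr
          exact exp_neg_one_le_one_sub_inv_pow n
  calc ((Real.exp (-1) / 2 * (Real.log M / n) : ℝ) : EReal)
      ≤ (ENNReal.ofReal ((1 - δ) ^ n * (δ * Real.log M)) : ℝ≥0∞) := by
        rw [EReal.coe_ennreal_ofReal]
        exact EReal.coe_le_coe_iff.2 (hrate.trans (le_max_left _ _))
    _ ≤ klRisk ν fhat (fs j) := EReal.coe_ennreal_le_coe_ennreal_iff.2 (by simpa using hj)
    _ = excessRisk ν fs fhat (fs j) := by rw [excessRisk, hmin, EReal.coe_ennreal_zero, sub_zero]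
    _ ≤ ⨆ f ∈ densitiesBoundedBy ν A, excessRisk ν fs fhat f := le_iSup₂_of_le _ (hfs j) le_rfl

/-- The unit cube with lower corner `(k, …, k)`. -/
def diagonalCube (d k : ℕ) : Set (Fin d → ℝ) := Set.univ.pi fun _ => Set.Ico (k : ℝ) (k + 1)

lemma measurableSet_diagonalCube (d k : ℕ) : MeasurableSet (diagonalCube d k) :=
  MeasurableSet.univ_pi fun _ => measurableSet_Ico

lemma volume_diagonalCube (d k : ℕ) : volume (diagonalCube d k) = 1 := by
  simp [diagonalCube, volume_pi_pi]

lemma pairwise_disjoint_diagonalCube {d : ℕ} (hd : 1 ≤ d) :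
    Pairwise (Function.onFun Disjoint (diagonalCube d)) := fun k l hkl =>
  Set.disjoint_univ_pi.2 ⟨⟨0, hd⟩, by
    simpa using Set.pairwise_disjoint_Ico_intCast ℝ (Nat.cast_injective.ne hkl : (k : ℤ) ≠ l)⟩

end LowerBound

end

end DensityAggregation

section

open DensityAggregation

theorem mainTheorem1_general {X : Type*} [MeasurableSpace X] {ν : Measure X} [SFinite ν]
    {B : ℕ → Set X} (hB : ∀ k, MeasurableSet (B k)) (hν : ∀ k, ν (B k) = 1)
    (hd : Pairwise (Function.onFun Disjoint B)) {A : ℝ} (hA : 1 ≤ A) (range : ℕ → ℕ → Prop) :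
    IsOptimalRate ν (densitiesBoundedBy ν A) (densitiesBoundedBy ν A) range
        (fun M n => Real.log M / n) 1 (Real.exp (-1) / 2) ∧
      IsOptimalProcedure ν (densitiesBoundedBy ν A) (densitiesBoundedBy ν A) range
        (fun M n => Real.log M / n) 1 (Real.exp (-1) / 2) progressiveMixture := by
  have hlower := lowerBound_of_disjoint hB hν hd hA range
  have hupper : ∀ M : ℕ, 2 ≤ M → ∀ fs : Fin M → X → ℝ, (∀ j, fs j ∈ densitiesBoundedBy ν A) →
      ∀ n : ℕ, 1 ≤ n → range M n → AttainsUpperBound ν (densitiesBoundedBy ν A)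
        (densitiesBoundedBy ν A) fs (progressiveMixture M n fs) (1 * (Real.log M / n)) := by
    intro M hM fs hfs n hn _
    have : NeZero M := ⟨by omega⟩
    refine (attainsUpperBound_progressiveMixture (fun f hf => hf.1) hfs).mono ?_
    rw [one_mul]
    gcongr
    linarith
  exact ⟨⟨fun M hM fs hfs => ⟨fun n => progressiveMixture M n fs, hupper M hM fs hfs⟩, hlower⟩,
    hupper, hlower⟩

end

theorem mainTheorem1 (A : ℝ) (hA : 1 < A) :
    ∃ C c : ℝ, 0 < C ∧ 0 < c ∧ ∀ d : ℕ, 1 ≤ d →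
      DensityAggregation.IsOptimalRate
        (volume : Measure (Fin d → ℝ))
        (DensityAggregation.densitiesBoundedBy volume A)
        (DensityAggregation.densitiesBoundedBy volume A)
        (fun M n => Real.log M ≤ 16 * (min 1 (A - 1)) ^ 2 * n)
        (fun M n => Real.log M / n) C c ∧
      DensityAggregation.IsOptimalProcedure
        (volume : Measure (Fin d → ℝ))
        (DensityAggregation.densitiesBoundedBy volume A)
        (DensityAggregation.densitiesBoundedBy volume A)
        (fun M n => Real.log M ≤ 16 * (min 1 (A - 1)) ^ 2 * n)
        (fun M n => Real.log M / n) C c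
        DensityAggregation.progressiveMixture := by
  exact ⟨1, Real.exp (-1) / 2, one_pos, by positivity, fun d hd => mainTheorem1_general
    (DensityAggregation.measurableSet_diagonalCube d) (DensityAggregation.volume_diagonalCube d)
    (DensityAggregation.pairwise_disjoint_diagonalCube hd) hA.le _⟩
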